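/- Let $0\le\ell\le n$, $0\le \ell'\le N$. On $\mathbb C^{n+1}$ with coordinates $(z,w)=(z_1,\dots,z_n,w)$ put $$\rho(z,w)=\frac{w-\bar w}{2i}-\sum_{\alpha=1}^n\varepsilon_\alpha|z_\alpha|^2,\qquad \varepsilon_\alpha=-1\ (\alpha\le \ell),\quad \varepsilon_\alpha=1\ (\alpha>\ell),$$ and $\mathbb H^{2n+1}_\ell=\{\rho=0\}$. Define $\rho'$ and $\mathbb H^{2N+1}_{\ell'}$ on $\mathbb C^{N+1}$ in the same way, with signs $\epsilon_k=-1$ for $k\le\ell'$ and $\epsilon_k=1$ for $k>\ell'$. Let $$Z_\alpha=\partial_{z_\alpha}+2i\varepsilon_\alpha\bar z_\alpha\partial_w,\qquad Z_{\bar\beta}=\overline{Z_\beta},\qquad h_{\alpha\bar\beta}=\varepsilon_\alpha\delta_{\alpha\beta}.$$ Let $U\subset\mathbb C^{n+1}$ be open and let $H=(F^1,\dots,F^N,G)\colon U\to\mathbb C^{N+1}$ be a holomorphic map with $H(U\cap\mathbb H^{2n+1}_\ell)\subset\mathbb H^{2N+1}_{\ell'}$ that is transversal to $\mathbb H^{2N+1}_{\ell'}$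 at every point $p$ of $U\cap\mathbb H^{2n+1}_\ell$, i.e. $T_{H(p)}\mathbb H^{2N+1}_{\ell'}+dH_p(\mathbb C^{n+1})=\mathbb C^{N+1}$. (1) There is a non-vanishing smooth real-valued function $Q$ on an open set $V\subset U$ containing $U\cap\mathbb H^{2n+1}_\ell$ such that $\rho'\circ H=Q\,\rho$ on $V$. (2) Let $V$ and $Q$ be as in (1), with $Q>0$ along $U\cap\mathbb H^{2n+1}_\ell$, and let $\mathcal A_{\alpha\bar\beta}(H)$ be the Hermitian part of the CR Ahlfors derivative of $H$ with respect to the standard pseudo-Hermitian structures, that is, the complex Hessian of $\log Q$ on the frame: $\mathcal A_{\alpha\bar\beta}(H)=\sum_{a,b}Z_\alpha^a\,\overline{Z_\beta^b}\,\frac{\partial^2\log Q}{\partial x_a\partial\bar x_b}$, where $x=(z,w)$ and $Z_\alpha=\sum_a Z_\alpha^a\partial_{x_a}$. Then, at every point of $U\cap\mathbb H^{2n+1}_\ell$ and for all $1\le\alpha,\beta\le n$, $$\begin{aligned}\mathcal A_{\alpha\bar\beta}(H)={}&-\frac{2i}{Q}\sum_{k=1}^N\epsilon_k(Z_\alpha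 F^k_w)(Z_{\bar\beta}\overline F^k)-\frac{4}{Q^2}\sum_{j,k=1}^N\epsilon_j\epsilon_k F^k_w(Z_{\bar\beta}\overline F^k)\,\overline F^j_{\bar w}(Z_\alpha F^j)\\&+\frac1Q\Bigl(iG_{ww}+2\sum_{k=1}^N\epsilon_k\overline F^kF^k_{ww}\Bigr)h_{\alpha\bar\beta}.\end{aligned}$$ (3) In the situation of (2), if moreover $0\in U$, $H(0)=0$, $G_w(0)=1$, $F^k_w(0)=0$ for all $k$, and $G_{ww}(0)=0$, then $$\mathcal A_{\alpha\bar\beta}(H)\big|_0=-2i\sum_{k=1}^N\epsilon_k\,\frac{\partial^2F^k}{\partial w\,\partial z_\alpha}(0)\;\overline{\frac{\partial F^k}{\partial z_\beta}(0)}.$$ -/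

import Mathlib

open scoped ComplexConjugate ContDiff

noncomputable section

namespace HyperquadricMaps

/-- The space `ℂ^{n+1}` with coordinates `(z, w)`, `z ∈ ℂ^n`, `w ∈ ℂ`. -/
abbrev CSpace (n : ℕ) : Type := (Fin n → ℂ) × ℂ

/-- The signs of the standard form of signature `ℓ`: `-1` for the first `ℓ` indices and
`1` for the remaining ones. -/
def sgn (ℓ : ℕ) {n : ℕ} (k : Fin n) : ℝ := if (k : ℕ) < ℓ then -1 else 1

/-- The defining function `ρ(z, w) = (w - w̄)/(2i) - ∑ ε_k |z_k|²` of the hyperquadric,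
where `(w - w̄)/(2i)` is the imaginary part of `w`. -/
def rho (ℓ n : ℕ) (p : CSpace n) : ℝ := p.2.im - ∑ k, sgn ℓ k * ‖p.1 k‖ ^ 2

/-- The real hyperquadric of dimension `2n+1` and signature `ℓ` in `ℂ^{n+1}`. -/
def hyperquadric (ℓ n : ℕ) : Set (CSpace n) := {p | rho ℓ n p = 0}

/-- Transversality at `p` of a map `H` to the target hyperquadric: the tangent space of the
hyperquadric at `H p` (the kernel of the differential of its defining function) together with
the image of the differential of `H` at `p` span the tangent space `ℂ^{N+1}`. -/
def TransversalAt (ℓ' : ℕ) {n N : ℕ} (H : CSpace n → CSpace N) (p : CSpace n) : Prop :=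
  (fderiv ℝ (rho ℓ' N) (H p)).ker ⊔ (fderiv ℝ H p).range = ⊤

/-- The function `Q` is a smooth, real-valued, non-vanishing function on a neighbourhood `V ⊆ U`
of the part of the source hyperquadric in `U`, and satisfies the mapping equation
`ρ' ∘ H = Q ρ` there. -/
structure IsMappingQuotient (ℓ ℓ' : ℕ) {n N : ℕ} (U : Set (CSpace n)) (H : CSpace n → CSpace N)
    (V : Set (CSpace n)) (Q : CSpace n → ℝ) : Prop where
  isOpen : IsOpen V
  subset : V ⊆ U
  nhds : U ∩ hyperquadric ℓ n ⊆ V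
  smooth : ContDiffOn ℝ ∞ Q V
  ne_zero : ∀ p ∈ V, Q p ≠ 0
  mapping_eq : ∀ p ∈ V, rho ℓ' N (H p) = Q p * rho ℓ n p

/-- The Wirtinger derivative of `f` at `p` along the `(1,0)`-vector `∑ v_a ∂/∂x_a`, where `x_a`
runs over the holomorphic coordinates. -/
def dHol {n : ℕ} (v : CSpace n) (f : CSpace n → ℂ) (p : CSpace n) : ℂ :=
  (fderiv ℝ f p v - Complex.I * fderiv ℝ f p (Complex.I • v)) / 2

/-- The Wirtinger derivative of `f` at `p` along the `(0,1)`-vector `∑ conj(v_a) ∂/∂x̄_a`, the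
complex conjugate of `∑ v_a ∂/∂x_a`. -/
def dAnti {n : ℕ} (v : CSpace n) (f : CSpace n → ℂ) (p : CSpace n) : ℂ :=
  (fderiv ℝ f p v + Complex.I * fderiv ℝ f p (Complex.I • v)) / 2

/-- The coordinate vector of `∂/∂z_α`. -/
def eZ {n : ℕ} (α : Fin n) : CSpace n := (Pi.single α 1, 0)

/-- The coordinate vector of `∂/∂w`. -/
def eW {n : ℕ} : CSpace n := (0, 1)

/-- The operator `∂/∂w`. -/
def dW {n : ℕ} (f : CSpace n → ℂ) (p : CSpace n) : ℂ := dHol eW f p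

/-- The operator `∂/∂w̄`. -/
def dWbar {n : ℕ} (f : CSpace n → ℂ) (p : CSpace n) : ℂ := dAnti eW f p

/-- The operator `∂/∂z_α`. -/
def dZ {n : ℕ} (α : Fin n) (f : CSpace n → ℂ) (p : CSpace n) : ℂ := dHol (eZ α) f p

/-- The value at `p` of the frame vector `Z_α = ∂/∂z_α + 2 i ε_α z̄_α ∂/∂w`. It annihilates
`ρ`, and `Z_1, …, Z_n` is a frame of the `(1,0)`-tangent spaces of the hyperquadric. -/
def frameVec (ℓ : ℕ) {n : ℕ} (α : Fin n) (p : CSpace n) : CSpace n :=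
  eZ α + (2 * Complex.I * (sgn ℓ α : ℂ) * conj (p.1 α)) • eW

/-- The differential operator `Z_α`. -/
def frameZ (ℓ : ℕ) {n : ℕ} (α : Fin n) (f : CSpace n → ℂ) (p : CSpace n) : ℂ :=
  dHol (frameVec ℓ α p) f p

/-- The differential operator `Z_β̄`, the conjugate of `Z_β`. -/
def frameZbar (ℓ : ℕ) {n : ℕ} (β : Fin n) (f : CSpace n → ℂ) (p : CSpace n) : ℂ :=
  dAnti (frameVec ℓ β p) f p

/-- The Levi matrix of the hyperquadric in the frame `Z_α`: `h_{αβ̄} = ε_α δ_{αβ}`. -/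
def leviMatrix (ℓ : ℕ) {n : ℕ} (α β : Fin n) : ℂ := if α = β then (sgn ℓ α : ℂ) else 0

/-- The complex Hessian `∑ v_a conj(v'_b) ∂²f/∂x_a∂x̄_b` at `p`, paired with the `(1,0)`-vector
`v` and the conjugate of the `(1,0)`-vector `v'`. Both vectors are constant in the
differentiation. -/
def complexHessian {n : ℕ} (f : CSpace n → ℂ) (p v v' : CSpace n) : ℂ :=
  dHol v (fun q => dAnti v' f q) p

/-- The Hermitian part `A_{αβ̄}` at `p` of the CR Ahlfors derivative of a hyperquadric map with
mapping quotient `Q > 0`, with respect to the standard pseudo-Hermitian structures: the complex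
Hessian of `log Q` on `Z_α, Z_β̄`. -/
def ahlfors (ℓ : ℕ) {n : ℕ} (Q : CSpace n → ℝ) (α β : Fin n) (p : CSpace n) : ℂ :=
  complexHessian (fun q => (Real.log (Q q) : ℂ)) p (frameVec ℓ α p) (frameVec ℓ β p)

/-- The component `F^k` of `H = (F, G)`. -/
def compF {n N : ℕ} (H : CSpace n → CSpace N) (k : Fin N) (p : CSpace n) : ℂ := (H p).1 k

/-- The conjugate of the component `F^k` of `H = (F, G)`. -/
def compFbar {n N : ℕ} (H : CSpace n → CSpace N) (k : Fin N) (p : CSpace n) : ℂ :=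
  conj (compF H k p)

/-- The component `G` of `H = (F, G)`. -/
def compG {n N : ℕ} (H : CSpace n → CSpace N) (p : CSpace n) : ℂ := (H p).2

end HyperquadricMaps

end

open HyperquadricMaps

/-!
On the source hyperquadric `M` the function `ρ' ∘ H` vanishes, and `ρ` is a coordinate along the
direction `∂/∂(Im w)`. Hadamard's lemma therefore gives a smooth quotient `Q` with
`ρ' ∘ H = Q ρ` (`exists_contDiffOn_eq_mul_of_eq_zero`); it needs `H` to be smooth, which for a
complex differentiable map of several variables follows from Cauchy's formula on complex lines
(`DifferentiableOn.contDiffOn_of_complex`). At a point of `M` the differential of `ρ' ∘ H` is `Q dρ`,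
and transversality makes it nonzero, so `Q` does not vanish near `M`.

The formula for the Ahlfors derivative comes from differentiating the mapping equation three times
at a point of `M`. The function `ρ' ∘ H` is a sum of products of holomorphic and antiholomorphic
functions (`polarized`), so its Wirtinger derivatives are explicit. On the other side, at `p ∈ M`
with the vectors `v = Z_α(p)` and `v' = Z_β(p)` held constant, one has
`ρ = ∂_v ρ = ∂_{v̄'} ρ = 0`, `∂_w ρ = 1/(2i)`, `∂_v ∂_{v̄'} ρ = -h_{αβ̄}`, and all second derivatives
of `ρ` with one factor `∂_w`, as well as its third derivatives, vanish. The Leibniz rule then leaves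
* `∂_w ∂_w`: an expression for `Q_w` (`dW_eq`),
* `∂_w ∂_{v̄'}` and its conjugate: expressions for `∂_{v̄'} Q` and `∂_v Q` (`frameZbar_eq`,
  `frameZ_eq`),
* `∂_w ∂_v ∂_{v̄'}`: the complex Hessian of `Q` (`complexHessian_eq`).

These combine in the Hessian of `log Q` (`complexHessian_log_eq`). At the origin, where
`Z_α = ∂_{z_α}`, the normalization gives `Q = 1` and only the first sum survives.
-/


/-! ### Smooth dependence of integrals on parameters -/

/-- Differentiation under the integral sign for a smooth integrand over a compact interval. -/
theorem hasFDerivAt_intervalIntegral_of_contDiff {E F : Type*} [NormedAddCommGroup E]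
    [NormedSpace ℝ E] [FiniteDimensional ℝ E] [NormedAddCommGroup F] [NormedSpace ℝ F]
    {f : E → ℝ → F} (hf : ContDiff ℝ ∞ (Function.uncurry f)) (a b : ℝ) (x₀ : E) :
    HasFDerivAt (fun x => ∫ t in a..b, f x t)
      (∫ t in a..b, (fderiv ℝ (Function.uncurry f) (x₀, t)).comp
        (ContinuousLinearMap.inl ℝ E ℝ)) x₀ := by
  have : ProperSpace E := FiniteDimensional.proper ℝ E
  have hD : Continuous fun q : E × ℝ =>
      (fderiv ℝ (Function.uncurry f) q).comp (ContinuousLinearMap.inl ℝ E ℝ) :=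
    (hf.continuous_fderiv (by simp)).clm_comp continuous_const
  have hK : IsCompact (Metric.closedBall x₀ 1 ×ˢ Set.uIcc a b) :=
    (isCompact_closedBall x₀ 1).prod isCompact_uIcc
  obtain ⟨C, hC⟩ := hK.exists_bound_of_continuousOn hD.continuousOn
  have hcont : ∀ x, Continuous (f x) := fun x =>
    hf.continuous.comp (Continuous.prodMk_right x)
  refine intervalIntegral.hasFDerivAt_integral_of_dominated_of_fderiv_le
    (F' := fun x t => (fderiv ℝ (Function.uncurry f) (x, t)).comp
      (ContinuousLinearMap.inl ℝ E ℝ)) (bound := fun _ => C)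
    (Metric.closedBall_mem_nhds x₀ one_pos)
    (.of_forall fun x => (hcont x).aestronglyMeasurable)
    ((hcont x₀).intervalIntegrable a b)
    (hD.comp (Continuous.prodMk_right x₀)).aestronglyMeasurable
    (.of_forall fun t ht x hx => hC (x, t) ⟨hx, Set.uIoc_subset_uIcc ht⟩)
    intervalIntegrable_const (.of_forall fun t ht x hx => ?_)
  have h1 : HasFDerivAt (fun x : E => (x, t)) (ContinuousLinearMap.inl ℝ E ℝ) x :=
    hasFDerivAt_prodMk_left x t
  exact ((hf.differentiable (by simp)) (x, t)).hasFDerivAt.comp x h1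

theorem contDiff_intervalIntegral {E F : Type*} [NormedAddCommGroup E]
    [NormedSpace ℝ E] [FiniteDimensional ℝ E] [NormedAddCommGroup F] [NormedSpace ℝ F]
    [CompleteSpace F]
    {f : E → ℝ → F} (hf : ContDiff ℝ ∞ (Function.uncurry f)) (a b : ℝ) :
    ContDiff ℝ ∞ (fun x => ∫ t in a..b, f x t) := by
  rw [contDiff_infty]
  intro m
  induction m generalizing f with
  | zero =>
    exact contDiff_zero.2 (continuous_iff_continuousAt.2 fun x =>
      (hasFDerivAt_intervalIntegral_of_contDiff hf a b x).continuousAt)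
  | succ m ih =>
    push_cast
    rw [contDiff_succ_iff_fderiv_apply]
    refine ⟨fun x => (hasFDerivAt_intervalIntegral_of_contDiff hf a b x).differentiableAt,
      by simp, fun y => ?_⟩
    have hD : ContDiff ℝ ∞ fun q : E × ℝ => (fderiv ℝ (Function.uncurry f) q).comp
        (ContinuousLinearMap.inl ℝ E ℝ) :=
      (hf.fderiv_right (by simp)).clm_comp contDiff_const
    have hDy : ContDiff ℝ ∞ (Function.uncurry fun (x : E) (t : ℝ) =>
        (fderiv ℝ (Function.uncurry f) (x, t)).comp (ContinuousLinearMap.inl ℝ E ℝ) y) :=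
      hD.clm_apply contDiff_const
    convert ih hDy using 2 with x
    rw [(hasFDerivAt_intervalIntegral_of_contDiff hf a b x).fderiv,
      ContinuousLinearMap.intervalIntegral_apply]
    exact (hD.continuous.comp (Continuous.prodMk_right x)).intervalIntegrable a b

/-! ### Smooth division by a defining function -/

theorem fderiv_apply_eq_one_of_add_smul {E : Type*} [NormedAddCommGroup E] [NormedSpace ℝ E]
    {r : E → ℝ} {ν x : E} (hr : DifferentiableAt ℝ r x) (hν : ∀ t : ℝ, r (x + t • ν) = r x + t) :
    fderiv ℝ r x ν = 1 := by
  have h1 : HasDerivAt (fun t : ℝ => r (x + t • ν)) 1 0 := by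
    simp only [hν]
    exact (hasDerivAt_id _).const_add _
  have h2 : HasDerivAt (fun t : ℝ => x + t • ν) ν 0 := by
    simpa using ((hasDerivAt_id (0 : ℝ)).smul_const ν).const_add x
  have h3 : HasFDerivAt r (fderiv ℝ r x) (x + (0 : ℝ) • ν) := by
    simpa using hr.hasFDerivAt
  exact (h3.comp_hasDerivAt 0 h2).unique h1

/-- Local Hadamard division. Moving from `x` along `ν` by `-r x` reaches the zero set of `r`, and
`R x` is the integral of the derivative of `R` along that segment. A cutoff makes the segment
formula available globally. -/
theorem exists_eventually_eq_mul_of_eq_zero {E : Type*} [NormedAddCommGroup E] [NormedSpace ℝ E]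
    [FiniteDimensional ℝ E] {r R : E → ℝ} {ν : E} {U : Set E} {p : E}
    (hr : ContDiff ℝ ∞ r) (hν : ∀ x (t : ℝ), r (x + t • ν) = r x + t)
    (hU : IsOpen U) (hp : p ∈ U) (hR : ContDiffOn ℝ ∞ R U)
    (h0 : ∀ x ∈ U, r x = 0 → R x = 0) :
    ∃ q : E → ℝ, ContDiff ℝ ∞ q ∧ ∀ᶠ x in nhds p, R x = q x * r x := by
  obtain ⟨δ, hδ, hball⟩ := Metric.isOpen_iff.1 hU p hp
  let χ : ContDiffBump p := ⟨δ / 4, δ / 2, by positivity, by linarith⟩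
  have hsupp : tsupport χ ⊆ U := by
    rw [χ.tsupport_eq]
    exact (Metric.closedBall_subset_ball (by change δ / 2 < δ; linarith)).trans hball
  let g : E → ℝ := fun x => χ x * R x
  have hg : ContDiff ℝ ∞ g := by
    rw [contDiff_iff_contDiffAt]
    intro x
    by_cases hx : x ∈ tsupport χ
    · exact χ.contDiff.contDiffAt.mul (hR.contDiffAt (hU.mem_nhds (hsupp hx)))
    · have : g =ᶠ[nhds x] fun _ => 0 := by
        filter_upwards [(isClosed_tsupport χ).isOpen_compl.mem_nhds hx] with y hy
        simp [g, image_eq_zero_of_notMem_tsupport hy]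
      exact contDiffAt_const.congr_of_eventuallyEq this
  have hg0 : ∀ x, r x = 0 → g x = 0 := by
    intro x hx
    by_cases hxs : x ∈ tsupport χ
    · simp [g, h0 x (hsupp hxs) hx]
    · simp [g, image_eq_zero_of_notMem_tsupport hxs]
  let γ : E → ℝ → E := fun x s => x + ((s - 1) * r x) • ν
  have hγ : ContDiff ℝ ∞ (Function.uncurry γ) := by
    have h1 : ContDiff ℝ ∞ fun q : E × ℝ => r q.1 := hr.comp contDiff_fst
    change ContDiff ℝ ∞ fun q : E × ℝ => q.1 + ((q.2 - 1) * r q.1) • ν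
    fun_prop
  have hD : ContDiff ℝ ∞ (Function.uncurry fun x s => fderiv ℝ g (γ x s) ν) :=
    ((hg.fderiv_right (by simp)).comp hγ).clm_apply contDiff_const
  refine ⟨fun x => ∫ s in (0 : ℝ)..1, fderiv ℝ g (γ x s) ν,
    contDiff_intervalIntegral hD 0 1, ?_⟩
  filter_upwards [Metric.ball_mem_nhds p χ.rIn_pos] with x hx
  have hχx : χ x = 1 := χ.one_of_mem_closedBall (Metric.ball_subset_closedBall hx)
  have hderiv : ∀ s ∈ Set.uIcc (0 : ℝ) 1,
      HasDerivAt (fun s => g (γ x s)) (fderiv ℝ g (γ x s) ν * r x) s := by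
    intro s _
    have h1 : HasDerivAt (γ x) (r x • ν) s := by
      have : HasDerivAt (fun s : ℝ => (s - 1) * r x) (1 * r x) s :=
        ((hasDerivAt_id s).sub_const 1).mul_const _
      rw [one_mul] at this
      exact (this.smul_const ν).const_add x
    have := ((hg.differentiable (by simp)) (γ x s)).hasFDerivAt.comp_hasDerivAt s h1
    rwa [map_smul, smul_eq_mul, mul_comm] at this
  have hcont : Continuous fun s => fderiv ℝ g (γ x s) ν * r x :=
    (hD.continuous.comp (Continuous.prodMk_right x)).mul continuous_const
  have hFTC := intervalIntegral.integral_eq_sub_of_hasDerivAt hderiv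
    (hcont.intervalIntegrable 0 1)
  have hγ0 : g (γ x 0) = 0 := hg0 _ (by simp only [γ, hν]; ring)
  have hγ1 : g (γ x 1) = R x := by simp [γ, g, hχx]
  rw [hγ0, hγ1, sub_zero, intervalIntegral.integral_mul_const] at hFTC
  exact hFTC.symm

/-- Smooth division: a smooth function vanishing on the zero set of `r` is a smooth multiple of
`r`, where `r` is a coordinate along the constant direction `ν`. On the zero set the quotient is
the derivative of `R` along `ν`. -/
theorem exists_contDiffOn_eq_mul_of_eq_zero {E : Type*} [NormedAddCommGroup E] [NormedSpace ℝ E]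
    [FiniteDimensional ℝ E] {r R : E → ℝ} {ν : E} {U : Set E}
    (hr : ContDiff ℝ ∞ r) (hν : ∀ x (t : ℝ), r (x + t • ν) = r x + t)
    (hU : IsOpen U) (hR : ContDiffOn ℝ ∞ R U) (h0 : ∀ x ∈ U, r x = 0 → R x = 0) :
    ∃ q : E → ℝ, ContDiffOn ℝ ∞ q U ∧ ∀ x ∈ U, R x = q x * r x := by
  classical
  have hrν (x : E) : fderiv ℝ r x ν = 1 :=
    fderiv_apply_eq_one_of_add_smul (hr.differentiable (by simp) x) (hν x)
  refine ⟨fun x => if r x = 0 then fderiv ℝ R x ν else R x / r x, fun p hp => ?_, ?_⟩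
  · obtain ⟨q, hq, hqR⟩ := exists_eventually_eq_mul_of_eq_zero hr hν hU hp hR h0
    refine (hq.contDiffAt.congr_of_eventuallyEq ?_).contDiffWithinAt
    filter_upwards [hqR.eventually_nhds] with x hx
    split_ifs with hx0
    · have hfd : fderiv ℝ R x = fderiv ℝ (fun y => q y * r y) x := Filter.EventuallyEq.fderiv_eq hx
      rw [hfd, fderiv_fun_mul (hq.differentiable (by simp) x) (hr.differentiable (by simp) x)]
      simp [hx0, hrν]
    · rw [hx.self_of_nhds, mul_div_cancel_right₀ _ hx0]
  · intro x hx
    by_cases hx0 : r x = 0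
    · simp [hx0, h0 x hx hx0]
    · simp [hx0]

/-! ### Smoothness of holomorphic maps of several variables -/

/-- Directional derivatives of a holomorphic map are holomorphic: by Cauchy's formula the
derivative along `v` is an average of `f` over circles in the direction `v`, which may be
differentiated under the integral sign since the Cauchy estimates bound `fderiv ℂ f` locally. -/
theorem DifferentiableOn.fderiv_apply_of_complex {E F : Type*} [NormedAddCommGroup E]
    [NormedSpace ℂ E] [FiniteDimensional ℂ E] [NormedAddCommGroup F] [NormedSpace ℂ F]
    [FiniteDimensional ℂ F] {f : E → F} {U : Set E} (hU : IsOpen U)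
    (hf : DifferentiableOn ℂ f U) (v : E) :
    DifferentiableOn ℂ (fun x => fderiv ℂ f x v) U := by
  have : CompleteSpace F := FiniteDimensional.complete ℂ F
  have : ProperSpace (E →L[ℂ] F) := FiniteDimensional.proper ℂ _
  borelize E
  borelize (E →L[ℂ] F)
  intro p hp
  have hcont : ContinuousAt f p := (hf.differentiableAt (hU.mem_nhds hp)).continuousAt
  obtain ⟨δ, hδ, hball⟩ : ∃ δ > 0, Metric.ball p δ ⊆ U ∩ f ⁻¹' Metric.ball (f p) 1 :=
    Metric.mem_nhds_iff.1
      (Filter.inter_mem (hU.mem_nhds hp) (hcont.preimage_mem_nhds (Metric.ball_mem_nhds _ one_pos)))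
  have hdiff : ∀ x ∈ Metric.ball p δ, DifferentiableAt ℂ f x := fun x hx =>
    hf.differentiableAt (hU.mem_nhds (hball hx).1)
  have hbound : ∀ x ∈ Metric.ball p (δ / 2), ‖fderiv ℂ f x‖ ≤ 2 / (δ / 2) := by
    intro x hx
    have hsub : Metric.ball x (δ / 2) ⊆ Metric.ball p δ := by
      intro y hy
      rw [Metric.mem_ball] at *
      linarith [dist_triangle y x p]
    have hmaps : Set.MapsTo f (Metric.ball x (δ / 2)) (Metric.closedBall (f x) 2) := by
      intro y hy
      have h1 := (hball (hsub hy)).2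
      have h2 := (hball (hsub (Metric.mem_ball_self (by positivity)))).2
      simp only [Set.mem_preimage, Metric.mem_ball, Metric.mem_closedBall] at *
      linarith [dist_triangle_right (f y) (f x) (f p)]
    exact Complex.norm_fderiv_le_div_of_mapsTo_ball
      (fun y hy => (hdiff y (hsub hy)).differentiableWithinAt) hmaps (by positivity)
  -- The radius keeps the circles `x + z • v`, `‖z‖ = ε`, with `x` near `p`, inside the ball of
  -- radius `δ / 2`, where the derivative is bounded.
  let ε : ℝ := δ / (4 * (‖v‖ + 1))
  have hε : 0 < ε := by positivity
  have hεv : ε * ‖v‖ < δ / 4 := by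
    have : ε * (‖v‖ + 1) = δ / 4 := by simp only [ε]; field_simp
    nlinarith
  have hmem : ∀ x ∈ Metric.ball p (δ / 4), ∀ z : ℂ, ‖z‖ ≤ ε → x + z • v ∈ Metric.ball p (δ / 2) := by
    intro x hx z hz
    rw [Metric.mem_ball, dist_eq_norm] at *
    calc ‖x + z • v - p‖ = ‖(x - p) + z • v‖ := by congr 1; abel
      _ ≤ ‖x - p‖ + ‖z‖ * ‖v‖ := (norm_add_le _ _).trans (by rw [norm_smul])
      _ ≤ ‖x - p‖ + ε * ‖v‖ := by gcongr
      _ < δ / 2 := by linarith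
  have hhalf : Metric.ball p (δ / 2) ⊆ Metric.ball p δ := Metric.ball_subset_ball (by linarith)
  -- The kernel of Cauchy's formula for the derivative at the centre of the circle.
  let c : ℝ → ℂ := fun θ => _root_.deriv (circleMap 0 ε) θ * ((circleMap 0 ε θ) ^ 2)⁻¹
  have hc : Continuous c := by
    have h2 : Continuous (circleMap 0 ε) := continuous_circleMap 0 ε
    have h1 : Continuous (_root_.deriv (circleMap 0 ε)) := by
      have : _root_.deriv (circleMap 0 ε) = fun θ => circleMap 0 ε θ * Complex.I := by
        ext θ; simp [deriv_circleMap]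
      rw [this]; fun_prop
    refine h1.mul ((h2.pow 2).inv₀ fun θ => pow_ne_zero _ ?_)
    exact circleMap_ne_center hε.ne'
  have hcirc : ∀ θ, ‖circleMap 0 ε θ‖ ≤ ε := fun θ => by simp [abs_of_pos hε]
  have hcauchy : ∀ x ∈ Metric.ball p (δ / 4), fderiv ℂ f x v =
      (2 * Real.pi * Complex.I : ℂ)⁻¹ •
        ∫ θ in (0 : ℝ)..2 * Real.pi, c θ • f (x + circleMap 0 ε θ • v) := by
    intro x hx
    have hline : ∀ z : ℂ, HasDerivAt (fun z : ℂ => x + z • v) v z := fun z => by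
      simpa using ((hasDerivAt_id z).smul_const v).const_add x
    have hopen : IsOpen {z : ℂ | x + z • v ∈ Metric.ball p (δ / 2)} :=
      Metric.isOpen_ball.preimage (by fun_prop)
    have hd : DifferentiableOn ℂ (fun z : ℂ => f (x + z • v))
        {z : ℂ | x + z • v ∈ Metric.ball p (δ / 2)} := fun z hz =>
      ((hdiff _ (hhalf hz)).comp z (hline z).differentiableAt).differentiableWithinAt
    have h0 : fderiv ℂ f x v = _root_.deriv (fun z : ℂ => f (x + z • v)) 0 := by
      have h3 : HasFDerivAt f (fderiv ℂ f x) (x + (0 : ℂ) • v) := by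
        simpa using (hdiff x (Metric.ball_subset_ball (by linarith) hx)).hasFDerivAt
      exact (h3.comp_hasDerivAt 0 (hline 0)).deriv.symm
    rw [h0, ← Complex.two_pi_I_inv_smul_circleIntegral_sub_sq_inv_smul_of_differentiable
      hopen (R := ε) (c := 0) (fun z hz => hmem x hx z (by simpa using hz)) hd
      (Metric.mem_ball_self hε)]
    simp [circleIntegral, c, smul_smul]
  have hpath : ∀ x, Continuous fun θ : ℝ => x + circleMap 0 ε θ • v := fun x => by
    have := continuous_circleMap 0 ε
    fun_prop
  have hcontf : ∀ x ∈ Metric.ball p (δ / 4),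
      Continuous fun θ => c θ • f (x + circleMap 0 ε θ • v) := fun x hx => by
    refine hc.smul (continuous_iff_continuousAt.2 fun θ => ?_)
    exact ContinuousAt.comp (f := fun θ : ℝ => x + circleMap 0 ε θ • v)
      (hdiff _ (hhalf (hmem x hx _ (hcirc θ)))).continuousAt (hpath x).continuousAt
  have hp4 : Metric.ball p (δ / 4) ∈ nhds p := Metric.ball_mem_nhds p (by positivity)
  have hint := intervalIntegral.hasFDerivAt_integral_of_dominated_of_fderiv_le (𝕜 := ℂ)
    (μ := MeasureTheory.volume) (a := 0) (b := 2 * Real.pi) (x₀ := p)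
    (F := fun x θ => c θ • f (x + circleMap 0 ε θ • v))
    (F' := fun x θ => c θ • fderiv ℂ f (x + circleMap 0 ε θ • v))
    (bound := fun θ => ‖c θ‖ * (2 / (δ / 2))) hp4
    (Filter.eventually_of_mem hp4 fun x hx => (hcontf x hx).aestronglyMeasurable)
    ((hcontf p (mem_of_mem_nhds hp4)).intervalIntegrable _ _)
    (hc.aestronglyMeasurable.smul
      ((measurable_fderiv ℂ f).comp (hpath p).measurable).aestronglyMeasurable)
    (.of_forall fun θ _ x hx => by
      rw [norm_smul]
      gcongr
      exact hbound _ (hmem x hx _ (hcirc θ)))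
    ((hc.norm.mul continuous_const).intervalIntegrable _ _)
    (.of_forall fun θ _ x hx => by
      have h3 := (hdiff _ (hhalf (hmem x hx _ (hcirc θ)))).hasFDerivAt
      have h4 : HasFDerivAt (fun x => x + circleMap 0 ε θ • v) (ContinuousLinearMap.id ℂ E) x :=
        (hasFDerivAt_id x).add_const _
      exact (h3.comp x h4).const_smul (c θ))
  refine DifferentiableAt.differentiableWithinAt ?_
  refine ((hint.differentiableAt.const_smul (2 * Real.pi * Complex.I : ℂ)⁻¹)
    ).congr_of_eventuallyEq ?_
  filter_upwards [hp4] with x hx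
  exact hcauchy x hx

theorem DifferentiableOn.contDiffOn_of_complex {E F : Type*} [NormedAddCommGroup E]
    [NormedSpace ℂ E] [FiniteDimensional ℂ E] [NormedAddCommGroup F] [NormedSpace ℂ F]
    [FiniteDimensional ℂ F] {f : E → F} {U : Set E} (hU : IsOpen U)
    (hf : DifferentiableOn ℂ f U) : ContDiffOn ℂ ∞ f U := by
  rw [contDiffOn_infty]
  intro m
  induction m generalizing f with
  | zero => exact contDiffOn_zero.2 hf.continuousOn
  | succ m ih =>
    push_cast
    rw [contDiffOn_succ_iff_fderiv_of_isOpen hU, contDiffOn_clm_apply]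
    exact ⟨hf, by simp, fun v => ih (hf.fderiv_apply_of_complex hU v)⟩

/-! ### Wirtinger calculus -/

/-- The first-order operator `f ↦ (∂_v f + c ∂_{iv} f) / 2`. For `c = -i` and `c = i` it is the
Wirtinger derivative along the `(1,0)`-vector and the `(0,1)`-vector given by `v`. -/
noncomputable def wirtinger {n : ℕ} (c : ℂ) (v : CSpace n) (f : CSpace n → ℂ) (p : CSpace n) : ℂ :=
  (fderiv ℝ f p v + c * fderiv ℝ f p (Complex.I • v)) / 2

section Wirtinger

variable {n : ℕ} {V : Set (CSpace n)} {p : CSpace n} {f g : CSpace n → ℂ}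

theorem dHol_eq_wirtinger (v : CSpace n) : dHol v = wirtinger (-Complex.I) v := by
  ext f p; simp only [dHol, wirtinger]; ring

theorem dAnti_eq_wirtinger (v : CSpace n) : dAnti v = wirtinger Complex.I v := rfl

theorem wirtinger_congr (c : ℂ) (v : CSpace n) (hV : IsOpen V) (h : Set.EqOn f g V) (hp : p ∈ V) :
    wirtinger c v f p = wirtinger c v g p := by
  have : fderiv ℝ f p = fderiv ℝ g p :=
    (h.eventuallyEq_of_mem (hV.mem_nhds hp)).fderiv_eq
  simp only [wirtinger, this]

theorem wirtinger_add (c : ℂ) (v : CSpace n) (hf : DifferentiableAt ℝ f p)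
    (hg : DifferentiableAt ℝ g p) :
    wirtinger c v (fun q => f q + g q) p = wirtinger c v f p + wirtinger c v g p := by
  simp only [wirtinger, fderiv_fun_add hf hg, add_apply]
  ring

theorem wirtinger_mul (c : ℂ) (v : CSpace n) (hf : DifferentiableAt ℝ f p)
    (hg : DifferentiableAt ℝ g p) :
    wirtinger c v (fun q => f q * g q) p = wirtinger c v f p * g p + f p * wirtinger c v g p := by
  simp only [wirtinger, fderiv_fun_mul hf hg, add_apply,
    smul_apply, smul_eq_mul]
  ring

theorem wirtinger_const_mul (c : ℂ) (v : CSpace n) (a : ℂ) (hf : DifferentiableAt ℝ f p) :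
    wirtinger c v (fun q => a * f q) p = a * wirtinger c v f p := by
  simp only [wirtinger, fderiv_const_mul hf, smul_apply, smul_eq_mul]
  ring

theorem wirtinger_sum {ι : Type*} (s : Finset ι) (c : ℂ) (v : CSpace n) {f : ι → CSpace n → ℂ}
    (hf : ∀ i ∈ s, DifferentiableAt ℝ (f i) p) :
    wirtinger c v (fun q => ∑ i ∈ s, f i q) p = ∑ i ∈ s, wirtinger c v (f i) p := by
  simp only [wirtinger, fderiv_fun_sum hf, sum_apply, Finset.mul_sum,
    ← Finset.sum_add_distrib, Finset.sum_div]

theorem wirtinger_zero (c : ℂ) (v : CSpace n) : wirtinger c v 0 p = 0 := by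
  simp [wirtinger]

theorem conj_wirtinger (c : ℂ) (v : CSpace n) (f : CSpace n → ℂ) (p : CSpace n) :
    conj (wirtinger c v f p) = wirtinger (conj c) v (fun q => conj (f q)) p := by
  have h : fderiv ℝ (fun q => conj (f q)) p =
      (Complex.conjCLE : ℂ →L[ℝ] ℂ).comp (fderiv ℝ f p) :=
    Complex.conjCLE.comp_fderiv (f := f) (x := p)
  simp [wirtinger, h, Complex.conj_ofNat]

theorem dHol_conj (v : CSpace n) (f : CSpace n → ℂ) (p : CSpace n) :
    dHol v (fun q => conj (f q)) p = conj (dAnti v f p) := by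
  rw [dHol_eq_wirtinger, dAnti_eq_wirtinger, conj_wirtinger, Complex.conj_I]

theorem dAnti_conj (v : CSpace n) (f : CSpace n → ℂ) (p : CSpace n) :
    dAnti v (fun q => conj (f q)) p = conj (dHol v f p) := by
  rw [dHol_eq_wirtinger, dAnti_eq_wirtinger, conj_wirtinger, map_neg, Complex.conj_I, neg_neg]

theorem fderiv_real_eq_of_complex (hf : DifferentiableAt ℂ f p) (v : CSpace n) :
    fderiv ℝ f p v = fderiv ℂ f p v := by
  rw [hf.fderiv_restrictScalars ℝ]; rfl

theorem dHol_of_differentiableAt (hf : DifferentiableAt ℂ f p) (v : CSpace n) :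
    dHol v f p = fderiv ℂ f p v := by
  simp only [dHol, fderiv_real_eq_of_complex hf, map_smul, smul_eq_mul]
  linear_combination (-(1 / 2) * fderiv ℂ f p v) * Complex.I_mul_I

theorem dAnti_of_differentiableAt (hf : DifferentiableAt ℂ f p) (v : CSpace n) :
    dAnti v f p = 0 := by
  simp only [dAnti, fderiv_real_eq_of_complex hf, map_smul, smul_eq_mul]
  linear_combination ((1 / 2) * fderiv ℂ f p v) * Complex.I_mul_I

theorem DifferentiableOn.dHol (hV : IsOpen V) (hf : DifferentiableOn ℂ f V) (v : CSpace n) :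
    DifferentiableOn ℂ (dHol v f) V :=
  (hf.fderiv_apply_of_complex hV v).congr fun _ hq =>
    dHol_of_differentiableAt (hf.differentiableAt (hV.mem_nhds hq)) v

theorem dHol_comm (hV : IsOpen V) (hf : DifferentiableOn ℂ f V) (u v : CSpace n) (hp : p ∈ V) :
    dHol u (dHol v f) p = dHol v (dHol u f) p := by
  have hs : ContDiffAt ℂ ∞ f p := (hf.contDiffOn_of_complex hV).contDiffAt (hV.mem_nhds hp)
  have key : ∀ u v : CSpace n, dHol u (dHol v f) p = fderiv ℂ (fderiv ℂ f) p u v := by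
    intro u v
    rw [dHol_of_differentiableAt ((hf.dHol hV v).differentiableAt (hV.mem_nhds hp))]
    have h1 : dHol v f =ᶠ[nhds p] fun q => fderiv ℂ f q v := by
      filter_upwards [hV.mem_nhds hp] with q hq
      exact dHol_of_differentiableAt (hf.differentiableAt (hV.mem_nhds hq)) v
    have h2 : DifferentiableAt ℂ (fderiv ℂ f) p :=
      (hs.fderiv_right (m := ∞) (by simp)).differentiableAt (by simp)
    rw [h1.fderiv_eq, fderiv_clm_apply h2 (differentiableAt_const v)]
    simp
  rw [key, key]
  exact (hs.isSymmSndFDerivAt (by simpa using ENat.LEInfty.out)).eq u v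

theorem ContDiffOn.wirtinger (hV : IsOpen V) (hf : ContDiffOn ℝ ∞ f V) (c : ℂ) (v : CSpace n) :
    ContDiffOn ℝ ∞ (wirtinger c v f) V := by
  have h : ContDiffOn ℝ ∞ (fderiv ℝ f) V := hf.fderiv_of_isOpen hV (by simp)
  exact ((h.clm_apply contDiffOn_const).add
    (contDiffOn_const.mul (h.clm_apply contDiffOn_const))).div_const 2

theorem ContDiffOn.differentiableAt_real (hV : IsOpen V) (hf : ContDiffOn ℝ ∞ f V) (hp : p ∈ V) :
    DifferentiableAt ℝ f p :=
  (hf.contDiffAt (hV.mem_nhds hp)).differentiableAt (by simp)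

/-- The second-order Leibniz rule. -/
theorem wirtinger_wirtinger_mul (hV : IsOpen V) (hf : ContDiffOn ℝ ∞ f V)
    (hg : ContDiffOn ℝ ∞ g V) (c d : ℂ) (u v : CSpace n) (hp : p ∈ V) :
    wirtinger c u (wirtinger d v (fun q => f q * g q)) p =
      wirtinger c u (wirtinger d v f) p * g p + wirtinger d v f p * wirtinger c u g p +
      (wirtinger c u f p * wirtinger d v g p + f p * wirtinger c u (wirtinger d v g) p) := by
  have h1 := hf.wirtinger hV d v
  have h2 := hg.wirtinger hV d v
  rw [wirtinger_congr c u hV (fun q hq => wirtinger_mul d v (hf.differentiableAt_real hV hq)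
      (hg.differentiableAt_real hV hq)) hp,
    wirtinger_add, wirtinger_mul, wirtinger_mul]
  all_goals
    first
    | exact ContDiffOn.differentiableAt_real hV (by assumption) hp
    | exact ContDiffOn.differentiableAt_real hV (ContDiffOn.mul (by assumption) (by assumption)) hp

/-- The third-order Leibniz rule. -/
theorem wirtinger_wirtinger_wirtinger_mul (hV : IsOpen V) (hf : ContDiffOn ℝ ∞ f V)
    (hg : ContDiffOn ℝ ∞ g V) (b c d : ℂ) (t u v : CSpace n) (hp : p ∈ V) :
    wirtinger b t (wirtinger c u (wirtinger d v (fun q => f q * g q))) p =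
      wirtinger b t (wirtinger c u (wirtinger d v f)) p * g p +
        wirtinger c u (wirtinger d v f) p * wirtinger b t g p +
      (wirtinger b t (wirtinger d v f) p * wirtinger c u g p +
        wirtinger d v f p * wirtinger b t (wirtinger c u g) p) +
      (wirtinger b t (wirtinger c u f) p * wirtinger d v g p +
        wirtinger c u f p * wirtinger b t (wirtinger d v g) p +
      (wirtinger b t f p * wirtinger c u (wirtinger d v g) p +
        f p * wirtinger b t (wirtinger c u (wirtinger d v g)) p)) := by
  have hfv := hf.wirtinger hV d v
  have hgv := hg.wirtinger hV d v
  have hfu := hf.wirtinger hV c u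
  have hgu := hg.wirtinger hV c u
  have hfuv := hfv.wirtinger hV c u
  have hguv := hgv.wirtinger hV c u
  rw [wirtinger_congr b t hV (fun q hq => wirtinger_wirtinger_mul hV hf hg c d u v hq) hp,
    wirtinger_add, wirtinger_add, wirtinger_add, wirtinger_mul, wirtinger_mul, wirtinger_mul,
    wirtinger_mul]
  all_goals
    first
    | exact ContDiffOn.differentiableAt_real hV (by assumption) hp
    | exact ContDiffOn.differentiableAt_real hV (ContDiffOn.mul (by assumption) (by assumption)) hp
    | exact ContDiffOn.differentiableAt_real hV (ContDiffOn.add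
        (ContDiffOn.mul (by assumption) (by assumption))
        (ContDiffOn.mul (by assumption) (by assumption))) hp

end Wirtinger

/-! ### Polarized functions -/

/-- The function `a + conj b + ∑ c_k f_k conj g_k`. With holomorphic data such functions are
stable under all Wirtinger derivatives, and the defining function of a hyperquadric pulled back
by a holomorphic map has this form. -/
noncomputable def polarized {n N : ℕ} (c : Fin N → ℂ) (a b : CSpace n → ℂ)
    (f g : Fin N → CSpace n → ℂ) (q : CSpace n) : ℂ :=
  (a q + conj (b q)) + ∑ k, c k * (f k q * conj (g k q))

section Polarized

variable {n N : ℕ} {V : Set (CSpace n)} {p : CSpace n} {a b : CSpace n → ℂ}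
  {f g : Fin N → CSpace n → ℂ}

theorem DifferentiableOn.differentiableAt_real {f : CSpace n → ℂ} (hV : IsOpen V)
    (hf : DifferentiableOn ℂ f V) (hp : p ∈ V) : DifferentiableAt ℝ f p :=
  (hf.differentiableAt (hV.mem_nhds hp)).restrictScalars ℝ

theorem DifferentiableAt.conj_comp {f : CSpace n → ℂ} (hf : DifferentiableAt ℝ f p) :
    DifferentiableAt ℝ (fun q => conj (f q)) p :=
  Complex.conjCLE.differentiableAt.comp p hf

theorem wirtinger_polarized (d : ℂ) (v : CSpace n) (c : Fin N → ℂ)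
    (ha : DifferentiableAt ℝ a p) (hb : DifferentiableAt ℝ b p)
    (hf : ∀ k, DifferentiableAt ℝ (f k) p) (hg : ∀ k, DifferentiableAt ℝ (g k) p) :
    wirtinger d v (polarized c a b f g) p =
      (wirtinger d v a p + wirtinger d v (fun q => conj (b q)) p) +
      ∑ k, c k * (wirtinger d v (f k) p * conj (g k p) +
        f k p * wirtinger d v (fun q => conj (g k q)) p) := by
  have h (k : Fin N) : DifferentiableAt ℝ (fun q => f k q * conj (g k q)) p :=
    (hf k).mul (hg k).conj_comp
  unfold polarized
  rw [wirtinger_add d v (ha.fun_add hb.conj_comp)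
      (DifferentiableAt.fun_sum fun k _ => (h k).const_mul (c k)),
    wirtinger_add d v ha hb.conj_comp, wirtinger_sum _ d v fun k _ => (h k).const_mul (c k)]
  congr 1
  refine Finset.sum_congr rfl fun k _ => ?_
  rw [wirtinger_const_mul d v _ (h k), wirtinger_mul d v (hf k) (hg k).conj_comp]

theorem dHol_polarized (hV : IsOpen V) (c : Fin N → ℂ) (v : CSpace n)
    (ha : DifferentiableOn ℂ a V) (hb : DifferentiableOn ℂ b V)
    (hf : ∀ k, DifferentiableOn ℂ (f k) V) (hg : ∀ k, DifferentiableOn ℂ (g k) V) (hp : p ∈ V) :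
    dHol v (polarized c a b f g) p =
      polarized c (dHol v a) 0 (fun k => dHol v (f k)) g p := by
  have hz (k : Fin N) := dAnti_of_differentiableAt ((hg k).differentiableAt (hV.mem_nhds hp)) v
  rw [dHol_eq_wirtinger, wirtinger_polarized _ v c (ha.differentiableAt_real hV hp)
    (hb.differentiableAt_real hV hp) (fun k => (hf k).differentiableAt_real hV hp)
    (fun k => (hg k).differentiableAt_real hV hp), ← dHol_eq_wirtinger]
  simp [polarized, dHol_conj, hz, dAnti_of_differentiableAt (hb.differentiableAt (hV.mem_nhds hp))]

theorem dAnti_polarized (hV : IsOpen V) (c : Fin N → ℂ) (v : CSpace n)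
    (ha : DifferentiableOn ℂ a V) (hb : DifferentiableOn ℂ b V)
    (hf : ∀ k, DifferentiableOn ℂ (f k) V) (hg : ∀ k, DifferentiableOn ℂ (g k) V) (hp : p ∈ V) :
    dAnti v (polarized c a b f g) p =
      polarized c 0 (dHol v b) f (fun k => dHol v (g k)) p := by
  have hz (k : Fin N) := dAnti_of_differentiableAt ((hf k).differentiableAt (hV.mem_nhds hp)) v
  rw [dAnti_eq_wirtinger, wirtinger_polarized _ v c (ha.differentiableAt_real hV hp)
    (hb.differentiableAt_real hV hp) (fun k => (hf k).differentiableAt_real hV hp)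
    (fun k => (hg k).differentiableAt_real hV hp), ← dAnti_eq_wirtinger]
  simp [polarized, dAnti_conj, hz, dAnti_of_differentiableAt (ha.differentiableAt (hV.mem_nhds hp))]

end Polarized

/-! ### Derivatives of the pulled back defining function -/

section RhoComp

variable {n N : ℕ} {V : Set (CSpace n)} {p : CSpace n} {H : CSpace n → CSpace N}

theorem DifferentiableOn.compF (hH : DifferentiableOn ℂ H V) (k : Fin N) :
    DifferentiableOn ℂ (compF H k) V :=
  differentiableOn_pi.1 hH.fst k

theorem DifferentiableOn.compG (hH : DifferentiableOn ℂ H V) : DifferentiableOn ℂ (compG H) V :=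
  hH.snd

theorem rho_comp_eq_polarized (ℓ' : ℕ) (H : CSpace n → CSpace N) :
    (fun q => (rho ℓ' N (H q) : ℂ)) =
      polarized (fun k => -(sgn ℓ' k : ℂ)) (fun q => -(Complex.I / 2) * compG H q)
        (fun q => -(Complex.I / 2) * compG H q) (compF H) (compF H) := by
  ext q
  have him : ((H q).2.im : ℂ) = -(Complex.I / 2) * ((H q).2 - conj (H q).2) := by
    rw [Complex.sub_conj]
    push_cast
    linear_combination ((H q).2.im : ℂ) * Complex.I_mul_I
  simp only [rho, polarized, compF, compG, Complex.ofReal_sub, Complex.ofReal_sum,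
    Complex.ofReal_mul, Complex.ofReal_pow, Complex.mul_conj', him, map_mul, map_neg, map_div₀,
    Complex.conj_I, Complex.conj_ofNat, neg_mul, Finset.sum_neg_distrib]
  ring

theorem dHol_const_mul {f : CSpace n → ℂ} (hf : DifferentiableAt ℝ f p) (v : CSpace n) (a : ℂ) :
    dHol v (fun q => a * f q) p = a * dHol v f p := by
  rw [dHol_eq_wirtinger, wirtinger_const_mul _ v a hf]

theorem dHol_rho_comp (ℓ' : ℕ) (hV : IsOpen V) (hH : DifferentiableOn ℂ H V) (v : CSpace n)
    (hp : p ∈ V) :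
    dHol v (fun q => (rho ℓ' N (H q) : ℂ)) p =
      -(Complex.I / 2) * dHol v (compG H) p -
        ∑ k, (sgn ℓ' k : ℂ) * (dHol v (compF H k) p * conj (compF H k p)) := by
  rw [rho_comp_eq_polarized, dHol_polarized hV _ v (hH.compG.const_mul _) (hH.compG.const_mul _)
    hH.compF hH.compF hp, polarized, dHol_const_mul (hH.compG.differentiableAt_real hV hp)]
  simp [sub_eq_add_neg]

theorem dAnti_rho_comp (ℓ' : ℕ) (H : CSpace n → CSpace N) (v p : CSpace n) :
    dAnti v (fun q => (rho ℓ' N (H q) : ℂ)) p =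
      conj (dHol v (fun q => (rho ℓ' N (H q) : ℂ)) p) := by
  rw [← dAnti_conj]
  simp

theorem dHol_dHol_rho_comp (ℓ' : ℕ) (hV : IsOpen V) (hH : DifferentiableOn ℂ H V)
    (u v : CSpace n) (hp : p ∈ V) :
    dHol u (dHol v (fun q => (rho ℓ' N (H q) : ℂ))) p =
      -(Complex.I / 2) * dHol u (dHol v (compG H)) p -
        ∑ k, (sgn ℓ' k : ℂ) * (dHol u (dHol v (compF H k)) p * conj (compF H k p)) := by
  have hG := (hH.compG).dHol hV v
  have hz : DifferentiableOn ℂ (0 : CSpace n → ℂ) V := differentiableOn_const 0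
  have hF (k : Fin N) := (hH.compF k).dHol hV v
  have h1 : Set.EqOn (dHol v (fun q => (rho ℓ' N (H q) : ℂ)))
      (polarized (fun k => -(sgn ℓ' k : ℂ)) (fun q => -(Complex.I / 2) * dHol v (compG H) q) 0
        (fun k => dHol v (compF H k)) (compF H)) V := by
    intro q hq
    rw [dHol_rho_comp ℓ' hV hH v hq]
    simp [polarized, sub_eq_add_neg]
  rw [dHol_eq_wirtinger u, wirtinger_congr _ u hV h1 hp, ← dHol_eq_wirtinger,
    dHol_polarized hV _ u (hG.const_mul _) hz hF hH.compF hp, polarized,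
    dHol_const_mul (hG.differentiableAt_real hV hp)]
  simp [sub_eq_add_neg]

theorem dAnti_dHol_rho_comp (ℓ' : ℕ) (hV : IsOpen V) (hH : DifferentiableOn ℂ H V)
    (u v : CSpace n) (hp : p ∈ V) :
    dAnti v (dHol u (fun q => (rho ℓ' N (H q) : ℂ))) p =
      -∑ k, (sgn ℓ' k : ℂ) * (dHol u (compF H k) p * conj (dHol v (compF H k) p)) := by
  have hG := (hH.compG).const_mul (-(Complex.I / 2))
  have hz : DifferentiableOn ℂ (0 : CSpace n → ℂ) V := differentiableOn_const 0
  rw [rho_comp_eq_polarized, dAnti_eq_wirtinger, wirtinger_congr _ v hV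
    (fun q hq => dHol_polarized hV _ u hG hG hH.compF hH.compF hq) hp, ← dAnti_eq_wirtinger]
  change dAnti v (polarized _ _ _ _ _) p = _
  rw [dAnti_polarized hV _ v (hG.dHol hV u) hz
      (fun k => (hH.compF k).dHol hV u) hH.compF hp]
  simp [polarized, dHol_eq_wirtinger, wirtinger_zero]

theorem dHol_dAnti_rho_comp (ℓ' : ℕ) (hV : IsOpen V) (hH : DifferentiableOn ℂ H V)
    (u v : CSpace n) (hp : p ∈ V) :
    dHol u (dAnti v (fun q => (rho ℓ' N (H q) : ℂ))) p =
      polarized (fun k => -(sgn ℓ' k : ℂ)) 0 0 (fun k => dHol u (compF H k))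
        (fun k => dHol v (compF H k)) p := by
  have hG := (hH.compG).const_mul (-(Complex.I / 2))
  have hz : DifferentiableOn ℂ (0 : CSpace n → ℂ) V := differentiableOn_const 0
  rw [rho_comp_eq_polarized, dHol_eq_wirtinger u, wirtinger_congr _ u hV
    (fun q hq => dAnti_polarized hV _ v hG hG hH.compF hH.compF hq) hp, ← dHol_eq_wirtinger]
  change dHol u (polarized _ _ _ _ _) p = _
  rw [dHol_polarized hV _ u hz (hG.dHol hV v)
      hH.compF (fun k => (hH.compF k).dHol hV v) hp]
  simp [polarized, dHol_eq_wirtinger, wirtinger_zero]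

theorem dHol_dHol_dAnti_rho_comp (ℓ' : ℕ) (hV : IsOpen V) (hH : DifferentiableOn ℂ H V)
    (t u v : CSpace n) (hp : p ∈ V) :
    dHol t (dHol u (dAnti v (fun q => (rho ℓ' N (H q) : ℂ)))) p =
      -∑ k, (sgn ℓ' k : ℂ) * (dHol t (dHol u (compF H k)) p * conj (dHol v (compF H k) p)) := by
  have hz : DifferentiableOn ℂ (0 : CSpace n → ℂ) V := differentiableOn_const 0
  rw [dHol_eq_wirtinger t, wirtinger_congr _ t hV
    (fun q hq => dHol_dAnti_rho_comp ℓ' hV hH u v hq) hp, ← dHol_eq_wirtinger]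
  change dHol t (polarized _ _ _ _ _) p = _
  rw [dHol_polarized hV _ t hz hz
      (fun k => (hH.compF k).dHol hV u) (fun k => (hH.compF k).dHol hV v) hp]
  simp [polarized, dHol_eq_wirtinger, wirtinger_zero]

end RhoComp

/-! ### Derivatives of the defining function -/

section Rho

variable {n : ℕ} (ℓ : ℕ) (p : CSpace n)

theorem dHol_compF_id (v : CSpace n) (k : Fin n) :
    dHol v (compF id k) = fun _ => v.1 k := by
  ext q
  let L : CSpace n →L[ℂ] ℂ :=
    (ContinuousLinearMap.proj k).comp (ContinuousLinearMap.fst ℂ (Fin n → ℂ) ℂ)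
  have hL : compF id k = L := rfl
  rw [hL, dHol_of_differentiableAt L.differentiableAt, L.fderiv]
  rfl

theorem dHol_compG_id (v : CSpace n) : dHol v (compG (id : CSpace n → CSpace n)) = fun _ => v.2 := by
  ext q
  let L : CSpace n →L[ℂ] ℂ := ContinuousLinearMap.snd ℂ (Fin n → ℂ) ℂ
  have hL : compG (id : CSpace n → CSpace n) = L := rfl
  rw [hL, dHol_of_differentiableAt L.differentiableAt, L.fderiv]
  rfl

theorem dHol_const (v : CSpace n) (a : ℂ) : dHol v (fun _ => a) p = 0 := by
  simp [dHol]

theorem dHol_rho (v : CSpace n) :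
    dHol v (fun q => (rho ℓ n q : ℂ)) p =
      -(Complex.I / 2) * v.2 - ∑ k, (sgn ℓ k : ℂ) * (v.1 k * conj (p.1 k)) := by
  have := dHol_rho_comp ℓ isOpen_univ (differentiableOn_id (𝕜 := ℂ)) v (Set.mem_univ p)
  simpa [dHol_compF_id, dHol_compG_id, compF] using this

theorem dHol_frameVec_rho (α : Fin n) (q : CSpace n) :
    dHol (frameVec ℓ α q) (fun q => (rho ℓ n q : ℂ)) q = 0 := by
  rw [dHol_rho]
  simp only [frameVec, eZ, eW, Prod.fst_add, Prod.snd_add, Prod.smul_mk, smul_zero, add_zero,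
    zero_add, smul_eq_mul, mul_one, Pi.single_apply, ite_mul, one_mul, zero_mul, mul_ite, mul_zero,
    Finset.sum_ite_eq', Finset.mem_univ, if_true]
  linear_combination (-(sgn ℓ α : ℂ) * conj (q.1 α)) * Complex.I_mul_I

theorem dAnti_frameVec_rho (α : Fin n) (q : CSpace n) :
    dAnti (frameVec ℓ α q) (fun q => (rho ℓ n q : ℂ)) q = 0 := by
  have := dAnti_rho_comp ℓ id (frameVec ℓ α q) q
  simpa [dHol_frameVec_rho] using this

theorem dHol_eW_rho : dHol eW (fun q => (rho ℓ n q : ℂ)) p = -(Complex.I / 2) := by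
  simp [dHol_rho, eW]

theorem dHol_dHol_rho (u v : CSpace n) :
    dHol u (dHol v (fun q => (rho ℓ n q : ℂ))) p = 0 := by
  have := dHol_dHol_rho_comp ℓ isOpen_univ (differentiableOn_id (𝕜 := ℂ)) u v (Set.mem_univ p)
  simpa [dHol_compF_id, dHol_compG_id, dHol_const] using this

theorem dAnti_dHol_rho (u v : CSpace n) :
    dAnti v (dHol u (fun q => (rho ℓ n q : ℂ))) p = -∑ k, (sgn ℓ k : ℂ) * (u.1 k * conj (v.1 k)) := by
  have := dAnti_dHol_rho_comp ℓ isOpen_univ (differentiableOn_id (𝕜 := ℂ)) u v (Set.mem_univ p)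
  simpa [dHol_compF_id] using this

theorem dHol_dAnti_rho (u v : CSpace n) :
    dHol u (dAnti v (fun q => (rho ℓ n q : ℂ))) p = -∑ k, (sgn ℓ k : ℂ) * (u.1 k * conj (v.1 k)) := by
  have := dHol_dAnti_rho_comp ℓ isOpen_univ (differentiableOn_id (𝕜 := ℂ)) u v (Set.mem_univ p)
  simpa [dHol_compF_id, polarized] using this

theorem dHol_dHol_dAnti_rho (t u v : CSpace n) :
    dHol t (dHol u (dAnti v (fun q => (rho ℓ n q : ℂ)))) p = 0 := by
  have := dHol_dHol_dAnti_rho_comp ℓ isOpen_univ (differentiableOn_id (𝕜 := ℂ)) t u v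
    (Set.mem_univ p)
  simpa [dHol_compF_id, dHol_const] using this

theorem dHol_dAnti_frameVec_rho (α β : Fin n) :
    dHol (frameVec ℓ α p) (dAnti (frameVec ℓ β p) (fun q => (rho ℓ n q : ℂ))) p =
      -leviMatrix ℓ α β := by
  rw [dHol_dAnti_rho, leviMatrix]
  by_cases h : α = β
  · simp [frameVec, eZ, eW, Pi.single_apply, h]
  · simp [frameVec, eZ, eW, Pi.single_apply, h, Ne.symm h]

theorem contDiff_rho : ContDiff ℝ ∞ (rho ℓ n) := by
  have h (k : Fin n) : ContDiff ℝ ∞ fun p : CSpace n => ‖p.1 k‖ ^ 2 :=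
    ContDiff.norm_sq ℝ (by fun_prop)
  refine ContDiff.sub (Complex.imCLM.contDiff.comp contDiff_snd) ?_
  exact ContDiff.sum fun k _ => contDiff_const.mul (h k)

theorem rho_add_smul (t : ℝ) : rho ℓ n (p + t • (0, Complex.I)) = rho ℓ n p + t := by
  simp [rho]; ring

end Rho

/-! ### The mapping quotient and its derivatives -/

section Quotient

variable {n N ℓ ℓ' : ℕ} {U V : Set (CSpace n)} {H : CSpace n → CSpace N} {Q : CSpace n → ℝ}
  {p : CSpace n}

/-- At a transversal point the differential of `ρ' ∘ H` does not vanish: otherwise the image of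
the differential of `H` would lie in the kernel of `dρ'`, a proper subspace. -/
theorem HyperquadricMaps.TransversalAt.fderiv_rho_comp_ne_zero (h : TransversalAt ℓ' H p)
    (hH : DifferentiableAt ℝ H p) : fderiv ℝ (fun q => rho ℓ' N (H q)) p ≠ 0 := by
  intro h0
  have hd : DifferentiableAt ℝ (rho ℓ' N) (H p) := (contDiff_rho ℓ').differentiable (by simp) _
  have hcomp : (fderiv ℝ (rho ℓ' N) (H p)).comp (fderiv ℝ H p) = 0 := by
    rw [← fderiv_comp p hd hH]; exact h0
  have hle : (fderiv ℝ H p).range ≤ (fderiv ℝ (rho ℓ' N) (H p)).ker := by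
    rintro _ ⟨v, rfl⟩
    exact DFunLike.congr_fun hcomp v
  have htop : (fderiv ℝ (rho ℓ' N) (H p)).ker = ⊤ := by
    rw [← h]; exact (sup_eq_left.2 hle).symm
  have h4 : fderiv ℝ (rho ℓ' N) (H p) (0, Complex.I) = 1 :=
    fderiv_apply_eq_one_of_add_smul hd (rho_add_smul ℓ' _)
  have h5 : ((0, Complex.I) : CSpace N) ∈ (fderiv ℝ (rho ℓ' N) (H p)).ker := htop ▸ trivial
  exact one_ne_zero (h4.symm.trans h5)

theorem exists_isMappingQuotient (hU : IsOpen U) (hH : DifferentiableOn ℂ H U)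
    (hmaps : ∀ p ∈ U ∩ hyperquadric ℓ n, H p ∈ hyperquadric ℓ' N)
    (htrans : ∀ p ∈ U ∩ hyperquadric ℓ n, TransversalAt ℓ' H p) :
    ∃ (V : Set (CSpace n)) (Q : CSpace n → ℝ), IsMappingQuotient ℓ ℓ' U H V Q := by
  have hHs : ContDiffOn ℝ ∞ H U := (hH.contDiffOn_of_complex hU).restrict_scalars ℝ
  obtain ⟨q, hq, hRq⟩ := exists_contDiffOn_eq_mul_of_eq_zero (contDiff_rho ℓ) (rho_add_smul ℓ) hU
    ((contDiff_rho ℓ').comp_contDiffOn hHs) (fun x hx h0 => hmaps x ⟨hx, h0⟩)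
  -- The open set is the part of `U` where the quotient is nonzero.
  refine ⟨U ∩ q ⁻¹' {0}ᶜ, q, hq.continuousOn.isOpen_inter_preimage hU isOpen_compl_singleton,
    Set.inter_subset_left, fun p hp => ⟨hp.1, fun hq0 => ?_⟩, hq.mono Set.inter_subset_left,
    fun p hp => hp.2, fun p hp => hRq p hp.1⟩
  have hnhds := hU.mem_nhds hp.1
  refine TransversalAt.fderiv_rho_comp_ne_zero (htrans p hp)
    ((hHs.contDiffAt hnhds).differentiableAt (by simp)) ?_
  have heq : (fun x => rho ℓ' N (H x)) =ᶠ[nhds p] fun x => q x * rho ℓ n x :=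
    Filter.eventually_of_mem hnhds hRq
  rw [heq.fderiv_eq, fderiv_fun_mul ((hq.contDiffAt hnhds).differentiableAt (by simp))
    ((contDiff_rho ℓ).differentiable (by simp) p)]
  have hρ : rho ℓ n p = 0 := hp.2
  have hq0' : q p = 0 := hq0
  simp [hρ, hq0']

namespace HyperquadricMaps.IsMappingQuotient

theorem contDiffOn_ofReal (hQ : IsMappingQuotient ℓ ℓ' U H V Q) :
    ContDiffOn ℝ ∞ (fun q => (Q q : ℂ)) V :=
  Complex.ofRealCLM.contDiff.comp_contDiffOn hQ.smooth

theorem contDiff_ofReal_rho : ContDiff ℝ ∞ (fun q => (rho ℓ n q : ℂ)) :=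
  Complex.ofRealCLM.contDiff.comp (contDiff_rho ℓ)

theorem eqOn (hQ : IsMappingQuotient ℓ ℓ' U H V Q) :
    Set.EqOn (fun q => (rho ℓ' N (H q) : ℂ)) (fun q => (Q q : ℂ) * (rho ℓ n q : ℂ)) V :=
  fun q hq => by simp [hQ.mapping_eq q hq]

/-- The first derivative of the mapping equation along `∂_w`. -/
theorem eq_dW (hQ : IsMappingQuotient ℓ ℓ' U H V Q) (hH : DifferentiableOn ℂ H U)
    (hp : p ∈ U ∩ hyperquadric ℓ n) :
    (Q p : ℂ) = dW (compG H) p -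
      2 * Complex.I * ∑ k, (sgn ℓ' k : ℂ) * (dW (compF H k) p * conj (compF H k p)) := by
  have hpV := hQ.nhds hp
  have hρ : rho ℓ n p = 0 := hp.2
  have h := dHol_rho_comp ℓ' hQ.isOpen (hH.mono hQ.subset) eW hpV
  rw [dHol_eq_wirtinger, wirtinger_congr _ eW hQ.isOpen hQ.eqOn hpV,
    wirtinger_mul _ _ (hQ.contDiffOn_ofReal.differentiableAt_real hQ.isOpen hpV)
      (contDiff_ofReal_rho.differentiable (by simp) p), ← dHol_eq_wirtinger,
    dHol_eW_rho, hρ, Complex.ofReal_zero] at h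
  simp only [dW]
  linear_combination 2 * Complex.I * h + (Q p - dHol eW (compG H) p) * Complex.I_mul_I

/-- The second derivative of the mapping equation along `∂_w`. -/
theorem dW_eq (hQ : IsMappingQuotient ℓ ℓ' U H V Q) (hH : DifferentiableOn ℂ H U)
    (hp : p ∈ U ∩ hyperquadric ℓ n) :
    2 * Complex.I * dW (fun q => (Q q : ℂ)) p = Complex.I * dW (dW (compG H)) p +
      2 * ∑ k, (sgn ℓ' k : ℂ) * (dW (dW (compF H k)) p * conj (compF H k p)) := by
  have hpV := hQ.nhds hp
  have hρ : rho ℓ n p = 0 := hp.2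
  have h := dHol_dHol_rho_comp ℓ' hQ.isOpen (hH.mono hQ.subset) eW eW hpV
  have hρ2 := dHol_dHol_rho ℓ p eW eW
  have hρ1 := dHol_eW_rho ℓ p
  rw [dHol_eq_wirtinger] at hρ1 hρ2
  rw [dHol_eq_wirtinger, wirtinger_congr _ eW hQ.isOpen
      (fun q hq => wirtinger_congr _ eW hQ.isOpen hQ.eqOn hq) hpV,
    wirtinger_wirtinger_mul hQ.isOpen hQ.contDiffOn_ofReal contDiff_ofReal_rho.contDiffOn
      _ _ _ _ hpV, hρ1, hρ2, hρ, Complex.ofReal_zero, ← dHol_eq_wirtinger] at h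
  have hdW (f : CSpace n → ℂ) : dW f = dHol eW f := rfl
  simp only [hdW]
  linear_combination (-2) * h

/-- The mixed second derivative of the mapping equation along `∂_w` and `Z_β̄`. -/
theorem frameZbar_eq (hQ : IsMappingQuotient ℓ ℓ' U H V Q) (hH : DifferentiableOn ℂ H U)
    (hp : p ∈ U ∩ hyperquadric ℓ n) (β : Fin n) :
    frameZbar ℓ β (fun q => (Q q : ℂ)) p =
      -(2 * Complex.I) * ∑ k, (sgn ℓ' k : ℂ) *
        (dW (compF H k) p * conj (frameZ ℓ β (compF H k) p)) := by
  have hpV := hQ.nhds hp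
  have hρ : rho ℓ n p = 0 := hp.2
  have h := dAnti_dHol_rho_comp ℓ' hQ.isOpen (hH.mono hQ.subset) eW (frameVec ℓ β p) hpV
  have hρ3 : dAnti (frameVec ℓ β p) (dHol eW fun q => (rho ℓ n q : ℂ)) p = 0 := by
    rw [dAnti_dHol_rho]; simp [eW]
  have hρ2 := dAnti_frameVec_rho ℓ β p
  have hρ1 := dHol_eW_rho ℓ p
  rw [dHol_eq_wirtinger] at hρ1 hρ3
  rw [dAnti_eq_wirtinger] at hρ2 hρ3
  rw [dAnti_eq_wirtinger, dHol_eq_wirtinger eW, wirtinger_congr _ _ hQ.isOpen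
      (fun q hq => wirtinger_congr _ eW hQ.isOpen hQ.eqOn hq) hpV,
    wirtinger_wirtinger_mul hQ.isOpen hQ.contDiffOn_ofReal contDiff_ofReal_rho.contDiffOn
      _ _ _ _ hpV, hρ1, hρ2, hρ3, hρ, Complex.ofReal_zero, ← dHol_eq_wirtinger, ← dAnti_eq_wirtinger] at h
  simp only [frameZbar, frameZ, dW]
  linear_combination 2 * Complex.I * h +
    dAnti (frameVec ℓ β p) (fun q => (Q q : ℂ)) p * Complex.I_mul_I

/-- The conjugate of `frameZbar_eq`, as `Q` is real. -/
theorem frameZ_eq (hQ : IsMappingQuotient ℓ ℓ' U H V Q) (hH : DifferentiableOn ℂ H U)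
    (hp : p ∈ U ∩ hyperquadric ℓ n) (α : Fin n) :
    frameZ ℓ α (fun q => (Q q : ℂ)) p =
      2 * Complex.I * ∑ k, (sgn ℓ' k : ℂ) *
        (conj (dW (compF H k) p) * frameZ ℓ α (compF H k) p) := by
  have hz : DifferentiableOn ℂ (0 : CSpace n → ℂ) V := differentiableOn_const 0
  have h := congrArg conj (hQ.frameZbar_eq hH hp α)
  rw [frameZbar, ← dHol_conj] at h
  simpa [Complex.conj_ofNat, frameZ] using h

/-- The third derivative of the mapping equation along `∂_w`, `Z_α` and `Z_β̄`, where the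
frame vectors are constant and equal to their values at `p`. -/
theorem complexHessian_eq (hQ : IsMappingQuotient ℓ ℓ' U H V Q) (hH : DifferentiableOn ℂ H U)
    (hp : p ∈ U ∩ hyperquadric ℓ n) (α β : Fin n) :
    complexHessian (fun q => (Q q : ℂ)) p (frameVec ℓ α p) (frameVec ℓ β p) =
      2 * Complex.I * dW (fun q => (Q q : ℂ)) p * leviMatrix ℓ α β -
      2 * Complex.I * ∑ k, (sgn ℓ' k : ℂ) *
        (frameZ ℓ α (dW (compF H k)) p * conj (frameZ ℓ β (compF H k) p)) := by
  have hpV := hQ.nhds hp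
  have hHV := hH.mono hQ.subset
  have hρ : rho ℓ n p = 0 := hp.2
  -- `∂_w` moves inside, to match the order `Z_α F_w` of derivatives in the formula.
  have h := dHol_dHol_dAnti_rho_comp ℓ' hQ.isOpen hHV eW (frameVec ℓ α p) (frameVec ℓ β p) hpV
  simp only [dHol_comm hQ.isOpen (hHV.compF _) eW _ hpV] at h
  have hρw := dHol_eW_rho ℓ p
  have hρα := dHol_frameVec_rho ℓ α p
  have hρβ := dAnti_frameVec_rho ℓ β p
  have hρwα := dHol_dHol_rho ℓ p eW (frameVec ℓ α p)
  have hρwβ : dHol eW (dAnti (frameVec ℓ β p) fun q => (rho ℓ n q : ℂ)) p = 0 := by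
    rw [dHol_dAnti_rho]; simp [eW]
  have hραβ := dHol_dAnti_frameVec_rho ℓ p α β
  have hρ3 := dHol_dHol_dAnti_rho ℓ p eW (frameVec ℓ α p) (frameVec ℓ β p)
  simp only [dHol_eq_wirtinger eW, dHol_eq_wirtinger (frameVec ℓ α p), dAnti_eq_wirtinger]
    at hρw hρα hρβ hρwα hρwβ hραβ hρ3
  rw [dHol_eq_wirtinger eW, dHol_eq_wirtinger (frameVec ℓ α p), dAnti_eq_wirtinger,
    wirtinger_congr _ _ hQ.isOpen
      (fun q hq => wirtinger_congr _ _ hQ.isOpen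
        (fun q hq => wirtinger_congr _ _ hQ.isOpen hQ.eqOn hq) hq) hpV,
    wirtinger_wirtinger_wirtinger_mul hQ.isOpen hQ.contDiffOn_ofReal contDiff_ofReal_rho.contDiffOn
      _ _ _ _ _ _ hpV, hρw, hρα, hρβ, hρwα, hρwβ, hραβ, hρ3, hρ, Complex.ofReal_zero, ← dHol_eq_wirtinger,
    ← dHol_eq_wirtinger, ← dAnti_eq_wirtinger] at h
  have hdW (f : CSpace n → ℂ) : dW f = dHol eW f := rfl
  simp only [complexHessian, frameZ, hdW]
  linear_combination 2 * Complex.I * h +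
    dHol (frameVec ℓ α p) (dAnti (frameVec ℓ β p) fun q => (Q q : ℂ)) p * Complex.I_mul_I

/-- The complex Hessian of a logarithm. The identity `Q ∂ log Q = ∂ Q` is differentiated once
more. The sign of `Q` plays no role: for `Q < 0`, `Real.log Q` is `log |Q|`, which has the same
derivatives. -/
theorem complexHessian_log_eq (hQ : IsMappingQuotient ℓ ℓ' U H V Q) (hp : p ∈ V)
    (u v : CSpace n) :
    complexHessian (fun q => (Real.log (Q q) : ℂ)) p u v =
      complexHessian (fun q => (Q q : ℂ)) p u v / Q p -
        dHol u (fun q => (Q q : ℂ)) p * dAnti v (fun q => (Q q : ℂ)) p / (Q p : ℂ) ^ 2 := by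
  have hne : (Q p : ℂ) ≠ 0 := Complex.ofReal_ne_zero.2 (hQ.ne_zero p hp)
  have hL : ContDiffOn ℝ ∞ (fun q => (Real.log (Q q) : ℂ)) V :=
    Complex.ofRealCLM.contDiff.comp_contDiffOn (hQ.smooth.log hQ.ne_zero)
  have hfirst : Set.EqOn (dAnti v fun q => (Q q : ℂ))
      (fun q => (Q q : ℂ) * dAnti v (fun q => (Real.log (Q q) : ℂ)) q) V := by
    intro q hq
    have hd : HasFDerivAt Q (fderiv ℝ Q q) q :=
      ((hQ.smooth.contDiffAt (hQ.isOpen.mem_nhds hq)).differentiableAt (by simp)).hasFDerivAt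
    have h1 := (Complex.ofRealCLM.hasFDerivAt.comp q hd).fderiv
    have h2 := (Complex.ofRealCLM.hasFDerivAt.comp q (hd.log (hQ.ne_zero q hq))).fderiv
    have h1' : fderiv ℝ (fun q => (Q q : ℂ)) q = _ := h1
    have h2' : fderiv ℝ (fun q => (Real.log (Q q) : ℂ)) q = _ := h2
    have hne : (Q q : ℂ) ≠ 0 := Complex.ofReal_ne_zero.2 (hQ.ne_zero q hq)
    simp only [dAnti, h1', h2']
    simp
    field_simp
  have hLv := hL.wirtinger hQ.isOpen Complex.I v
  have h : dHol u (dAnti v fun q => (Q q : ℂ)) p =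
      dHol u (fun q => (Q q : ℂ)) p * dAnti v (fun q => (Real.log (Q q) : ℂ)) p +
        Q p * dHol u (dAnti v (fun q => (Real.log (Q q) : ℂ))) p := by
    rw [dHol_eq_wirtinger, wirtinger_congr _ u hQ.isOpen hfirst hp,
      wirtinger_mul (g := dAnti v _) _ _
        (hQ.contDiffOn_ofReal.differentiableAt_real hQ.isOpen hp)
        (hLv.differentiableAt_real hQ.isOpen hp)]
  have h0 : dAnti v (fun q => (Q q : ℂ)) p = _ := hfirst hp
  change dHol u (dAnti v fun q => (Real.log (Q q) : ℂ)) p =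
    dHol u (dAnti v fun q => (Q q : ℂ)) p / _ - _
  rw [h, h0]
  field_simp
  ring

/-- The Ahlfors derivative in terms of the map. -/
theorem ahlfors_eq (hQ : IsMappingQuotient ℓ ℓ' U H V Q) (hH : DifferentiableOn ℂ H U)
    (hp : p ∈ U ∩ hyperquadric ℓ n) (α β : Fin n) :
    ahlfors ℓ Q α β p =
      -(2 * Complex.I / (Q p : ℂ)) *
          ∑ k : Fin N, (sgn ℓ' k : ℂ) * frameZ ℓ α (dW (compF H k)) p *
            frameZbar ℓ β (compFbar H k) p
        - 4 / (Q p : ℂ) ^ 2 *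
          ∑ j : Fin N, ∑ k : Fin N, (sgn ℓ' j : ℂ) * (sgn ℓ' k : ℂ) *
            dW (compF H k) p * frameZbar ℓ β (compFbar H k) p *
            dWbar (compFbar H j) p * frameZ ℓ α (compF H j) p
        + 1 / (Q p : ℂ) *
          (Complex.I * dW (dW (compG H)) p +
            2 * ∑ k : Fin N, (sgn ℓ' k : ℂ) * compFbar H k p * dW (dW (compF H k)) p) *
          leviMatrix ℓ α β := by
  have hne : (Q p : ℂ) ≠ 0 := Complex.ofReal_ne_zero.2 (hQ.ne_zero p (hQ.nhds hp))
  have hbar (k : Fin N) : frameZbar ℓ β (compFbar H k) p = conj (frameZ ℓ β (compF H k) p) :=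
    dAnti_conj _ _ _
  have hwbar (k : Fin N) : dWbar (compFbar H k) p = conj (dW (compF H k) p) :=
    dAnti_conj _ _ _
  have hA := hQ.frameZ_eq hH hp α
  have hB := hQ.frameZbar_eq hH hp β
  simp only [frameZ, frameZbar] at hA hB
  rw [ahlfors, hQ.complexHessian_log_eq (hQ.nhds hp), hQ.complexHessian_eq hH hp,
    hQ.dW_eq hH hp, hA, hB]
  simp only [hbar, hwbar]
  have hdouble : ∑ j : Fin N, ∑ k : Fin N, (sgn ℓ' j : ℂ) * (sgn ℓ' k : ℂ) *
            dW (compF H k) p * conj (frameZ ℓ β (compF H k) p) *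
            conj (dW (compF H j) p) * frameZ ℓ α (compF H j) p =
      (∑ k, (sgn ℓ' k : ℂ) * (conj (dW (compF H k) p) * frameZ ℓ α (compF H k) p)) *
      ∑ k, (sgn ℓ' k : ℂ) * (dW (compF H k) p * conj (frameZ ℓ β (compF H k) p)) := by
    rw [Finset.sum_mul_sum]
    refine Finset.sum_congr rfl fun j _ => Finset.sum_congr rfl fun k _ => ?_
    ring
  have hs1 : ∑ k : Fin N, (sgn ℓ' k : ℂ) * compFbar H k p * dW (dW (compF H k)) p =
      ∑ k, (sgn ℓ' k : ℂ) * (dW (dW (compF H k)) p * conj (compF H k p)) :=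
    Finset.sum_congr rfl fun k _ => by rw [compFbar]; ring
  rw [hdouble, hs1]
  simp only [mul_assoc (sgn ℓ' _ : ℂ), frameZ]
  generalize ∑ k, (sgn ℓ' k : ℂ) * (conj (dW (compF H k) p) * dHol _ (compF H k) p) = A
  generalize ∑ k, (sgn ℓ' k : ℂ) * (dW (compF H k) p * conj (dHol _ (compF H k) p)) = B
  field_simp
  linear_combination 4 * A * B * Complex.I_mul_I

/-- The Ahlfors derivative of a normalized map at the origin. -/
theorem ahlfors_zero_eq (hQ : IsMappingQuotient ℓ ℓ' U H V Q) (hH : DifferentiableOn ℂ H U)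
    (h0 : (0 : CSpace n) ∈ U) (hH0 : H 0 = 0) (hG : dW (compG H) 0 = 1)
    (hF : ∀ k : Fin N, dW (compF H k) 0 = 0) (hGG : dW (dW (compG H)) 0 = 0) (α β : Fin n) :
    ahlfors ℓ Q α β 0 =
      -(2 * Complex.I) *
        ∑ k : Fin N, (sgn ℓ' k : ℂ) * dW (dZ α (compF H k)) 0 *
          conj (dZ β (compF H k) 0) := by
  have hp : (0 : CSpace n) ∈ U ∩ hyperquadric ℓ n := ⟨h0, by simp [hyperquadric, rho]⟩
  have hV := hQ.nhds hp
  have hF0 (k : Fin N) : compF H k 0 = 0 := by simp [compF, hH0]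
  have hQ0 : (Q 0 : ℂ) = 1 := by rw [hQ.eq_dW hH hp]; simp [hG, hF]
  have hv (γ : Fin n) : frameVec ℓ γ 0 = eZ γ := by simp [frameVec]
  rw [hQ.ahlfors_eq hH hp]
  have hbar (k : Fin N) : frameZbar ℓ β (compFbar H k) 0 = conj (dZ β (compF H k) 0) := by
    rw [frameZbar, hv]; exact dAnti_conj _ _ _
  have hcomm (k : Fin N) : frameZ ℓ α (dW (compF H k)) 0 = dW (dZ α (compF H k)) 0 := by
    rw [frameZ, hv]
    exact dHol_comm hQ.isOpen ((hH.mono hQ.subset).compF k) _ _ hV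
  simp [hQ0, hF, hGG, hbar, hcomm, compFbar, hF0]

end HyperquadricMaps.IsMappingQuotient

end Quotient

/-! ### The Ahlfors derivative of a hyperquadric map -/

theorem proposition3p1 (n N ℓ ℓ' : ℕ) (hℓ : ℓ ≤ n) (hℓ' : ℓ' ≤ N)
    (U : Set (CSpace n)) (hU : IsOpen U)
    (H : CSpace n → CSpace N) (hH : DifferentiableOn ℂ H U)
    (hmaps : ∀ p ∈ U ∩ hyperquadric ℓ n, H p ∈ hyperquadric ℓ' N)
    (htrans : ∀ p ∈ U ∩ hyperquadric ℓ n, TransversalAt ℓ' H p) :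
    (∃ (V : Set (CSpace n)) (Q : CSpace n → ℝ), IsMappingQuotient ℓ ℓ' U H V Q) ∧
    ∀ (V : Set (CSpace n)) (Q : CSpace n → ℝ), IsMappingQuotient ℓ ℓ' U H V Q →
      (∀ p ∈ U ∩ hyperquadric ℓ n, 0 < Q p) →
      (∀ p ∈ U ∩ hyperquadric ℓ n, ∀ α β : Fin n,
        ahlfors ℓ Q α β p =
          -(2 * Complex.I / (Q p : ℂ)) *
              ∑ k : Fin N, (sgn ℓ' k : ℂ) * frameZ ℓ α (dW (compF H k)) p *
                frameZbar ℓ β (compFbar H k) p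
            - 4 / (Q p : ℂ) ^ 2 *
              ∑ j : Fin N, ∑ k : Fin N, (sgn ℓ' j : ℂ) * (sgn ℓ' k : ℂ) *
                dW (compF H k) p * frameZbar ℓ β (compFbar H k) p *
                dWbar (compFbar H j) p * frameZ ℓ α (compF H j) p
            + 1 / (Q p : ℂ) *
              (Complex.I * dW (dW (compG H)) p +
                2 * ∑ k : Fin N, (sgn ℓ' k : ℂ) * compFbar H k p * dW (dW (compF H k)) p) *
              leviMatrix ℓ α β) ∧
      ((0 : CSpace n) ∈ U → H 0 = 0 → dW (compG H) 0 = 1 →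
        (∀ k : Fin N, dW (compF H k) 0 = 0) → dW (dW (compG H)) 0 = 0 →
        ∀ α β : Fin n,
          ahlfors ℓ Q α β 0 =
            -(2 * Complex.I) *
              ∑ k : Fin N, (sgn ℓ' k : ℂ) * dW (dZ α (compF H k)) 0 *
                conj (dZ β (compF H k) 0)) :=
  ⟨exists_isMappingQuotient hU hH hmaps htrans, fun _ _ hQ _ =>
    ⟨fun _ hp α β => hQ.ahlfors_eq hH hp α β,
      fun h0 hH0 hG hF hGG α β => hQ.ahlfors_zero_eq hH h0 hH0 hG hF hGG α β⟩⟩
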